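/- Let $X$ be a separable infinite-dimensional Banach space over $\mathbb{R}$ or $\mathbb{C}$. For $K\ge 1$ and $N \ge 2$, say that bounded linear operators $T_1,\dots,T_N$ on $X$ satisfy condition $(B_K)$ if for all non-empty open sets $W, U_{1-K},\dots,U_0,U_1,\dots,U_N\subseteq X$ with $0\in W$ there is an integer $n\ge 1$ such that $$W\cap T_1^{-n}(U_1)\cap\cdots\cap T_N^{-n}(U_N)\neq\emptyset \quad\text{and}\quad U_\ell\cap T_1^{-n}(W)\cap\cdots\cap T_N^{-n}(W)\neq\emptyset \ \text{ for all integers } 1-K\le \ell\le 0,$$ where $T_i^{-n}(A)=\{x\in X: T_i^n x\in A\}$. The operators satisfy the \emph{Disjoint Blow-up/Collapse property} if $(B_1)$ holds, and the \emph{Strong Disjoint Blow-up/Collapse property} if $(B_K)$ holds for every integer $K\ge 1$. Then there exist bounded linear operators $T_1,T_2$ on $X$ that satisfy the Disjoint Blow-up/Collapse property but do not satisfy the Strong Disjoint Blow-up/Collapse property. -/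

import Mathlib

/-- The blow-up/collapse condition for the operators `T 0, …, T (N - 1)` with a family of `K`
open sets `V 0, …, V (K - 1)` to be collapsed: whenever `W` is an open neighbourhood of `0` and
all `V l`, `U i` are non-empty open sets, one and the same `n ≥ 1` gives a point of `W` that the
powers `T i ^ n` send into the `U i`, and for every `l` a point of `V l` that all the powers
`T i ^ n` send into `W`. -/
def DisjointBlowUpCollapseOfSize {𝕜 X : Type*} [RCLike 𝕜] [NormedAddCommGroup X]
    [NormedSpace 𝕜 X] {N : ℕ} (T : Fin N → X →L[𝕜] X) (K : ℕ) : Prop :=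
  ∀ (W : Set X) (V : Fin K → Set X) (U : Fin N → Set X),
    IsOpen W → (0 : X) ∈ W →
    (∀ l, IsOpen (V l) ∧ (V l).Nonempty) →
    (∀ i, IsOpen (U i) ∧ (U i).Nonempty) →
    ∃ n : ℕ, 1 ≤ n ∧
      (W ∩ ⋂ i, (⇑(T i ^ n)) ⁻¹' (U i)).Nonempty ∧
      ∀ l, (V l ∩ ⋂ i, (⇑(T i ^ n)) ⁻¹' W).Nonempty

/-- The Disjoint Blow-up/Collapse property. -/
def DisjointBlowUpCollapse {𝕜 X : Type*} [RCLike 𝕜] [NormedAddCommGroup X]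
    [NormedSpace 𝕜 X] {N : ℕ} (T : Fin N → X →L[𝕜] X) : Prop :=
  DisjointBlowUpCollapseOfSize T 1

/-- The Strong Disjoint Blow-up/Collapse property. -/
def StrongDisjointBlowUpCollapse {𝕜 X : Type*} [RCLike 𝕜] [NormedAddCommGroup X]
    [NormedSpace 𝕜 X] {N : ℕ} (T : Fin N → X →L[𝕜] X) : Prop :=
  ∀ K : ℕ, 1 ≤ K → DisjointBlowUpCollapseOfSize T K

open Filter Topology

/-! Take `T` mixing in a strong sense and perturb it by a rank-two conjugation: `R = 1 + f₁ ⊗ e₁ +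
f₂ ⊗ e₂`, `T₂ = R⁻¹ T R`. Then `R T₂ⁿ x - Tⁿ x = f₁(x) Tⁿe₁ + f₂(x) Tⁿe₂`, so the joint behaviour of
`T, T₂` is governed by the pair `(Tⁿe₁, Tⁿe₂)`, which is chosen to cluster at every point of `E ×
E`. To collapse near one vector `v`, it suffices that this pair clusters at some `(z₁, z₂)` with
`f₁(v) z₁ + f₂(v) z₂ = 0`; this leaves `z₂` free to steer the blow-up. Collapsing near two vectors
on which `(f₁, f₂)` is almost the identity matrix instead bounds both `Tⁿe₁` and `Tⁿe₂`, so `Tⁿx`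
and `R T₂ⁿx` stay close for small `x` and cannot reach distant targets. Such a `T` exists on `X`
because translation of polynomials by `1` extends boundedly once monomials are sent to a rapidly
scaled biorthogonal system. -/

/-- A set of pairs (vector, functional) is biorthogonal if each functional takes the value `1` at
its own vector and vanishes at the vectors of all other pairs. -/
def IsBiorthogonal {𝕜 E : Type*} [RCLike 𝕜] [NormedAddCommGroup E] [NormedSpace 𝕜 E]
    (s : Set (E × (E →L[𝕜] 𝕜))) : Prop :=
  (∀ p ∈ s, p.2 p.1 = 1) ∧ ∀ p ∈ s, ∀ q ∈ s, p ≠ q → p.2 q.1 = 0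

/-! ### Biorthogonal systems with dense span -/

section Biorthogonal

variable {𝕜 E : Type*} [RCLike 𝕜] [NormedAddCommGroup E] [NormedSpace 𝕜 E]

open Classical in
/-- Gram–Schmidt step: a finite biorthogonal set can be enlarged so that a given vector lies in the
span of its vectors. -/
theorem IsBiorthogonal.exists_superset_mem_span {s : Finset (E × (E →L[𝕜] 𝕜))}
    (hs : IsBiorthogonal (s : Set (E × (E →L[𝕜] 𝕜)))) (d : E) :
    ∃ t : Finset (E × (E →L[𝕜] 𝕜)), IsBiorthogonal (t : Set (E × (E →L[𝕜] 𝕜))) ∧ s ⊆ t ∧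
      d ∈ Submodule.span 𝕜 (Prod.fst '' (t : Set (E × (E →L[𝕜] 𝕜)))) := by
  obtain ⟨h1, h0⟩ := hs
  have key : ∀ p ∈ s, ∀ a : E × (E →L[𝕜] 𝕜) → 𝕜, ∑ q ∈ s, a q * p.2 q.1 = a p := by
    intro p hp a
    rw [Finset.sum_eq_single_of_mem p hp, h1 p hp, mul_one]
    intro q hq hqp
    rw [h0 p hp q hq hqp.symm, mul_zero]
  have key' : ∀ p ∈ s, ∀ a : E × (E →L[𝕜] 𝕜) → 𝕜, ∑ q ∈ s, a q * q.2 p.1 = a p := by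
    intro p hp a
    rw [Finset.sum_eq_single_of_mem p hp, h1 p hp, mul_one]
    intro q hq hqp
    rw [h0 q hq p hp hqp, mul_zero]
  set x : E := d - ∑ p ∈ s, p.2 d • p.1 with hx
  have hpx : ∀ p ∈ s, p.2 x = 0 := by
    intro p hp
    simp only [hx, map_sub, map_sum, map_smul, smul_eq_mul]
    rw [key p hp (fun q => q.2 d), sub_self]
  have hspan : ∑ p ∈ s, p.2 d • p.1 ∈
      Submodule.span 𝕜 (Prod.fst '' (s : Set (E × (E →L[𝕜] 𝕜)))) :=
    Submodule.sum_mem _ fun p hp =>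
      Submodule.smul_mem _ _ (Submodule.subset_span ⟨p, hp, rfl⟩)
  by_cases hx0 : x = 0
  · refine ⟨s, ⟨h1, h0⟩, subset_rfl, ?_⟩
    rwa [sub_eq_zero.1 (hx.symm.trans hx0)]
  obtain ⟨ψ, hψ⟩ := SeparatingDual.exists_eq_one (R := 𝕜) hx0
  -- The correction makes `φ` vanish on the old vectors and keeps `φ x = 1`, as the old functionals
  -- vanish at `x`.
  set φ : E →L[𝕜] 𝕜 := ψ - ∑ p ∈ s, ψ p.1 • p.2 with hφ
  have hφx : φ x = 1 := by
    simp only [hφ, sub_apply, sum_apply,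
      smul_apply, hψ]
    rw [Finset.sum_eq_zero fun p hp => by rw [hpx p hp, smul_zero], sub_zero]
  have hφp : ∀ p ∈ s, φ p.1 = 0 := by
    intro p hp
    simp only [hφ, sub_apply, sum_apply,
      smul_apply, smul_eq_mul]
    rw [key' p hp (fun q => ψ q.1), sub_self]
  refine ⟨insert (x, φ) s, ⟨?_, ?_⟩, Finset.subset_insert _ _, ?_⟩
  · intro p hp
    rcases Finset.mem_insert.1 (Finset.mem_coe.1 hp) with rfl | hp
    · exact hφx
    · exact h1 p hp
  · intro p hp q hq hpq
    rcases Finset.mem_insert.1 (Finset.mem_coe.1 hp) with rfl | hp <;>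
      rcases Finset.mem_insert.1 (Finset.mem_coe.1 hq) with rfl | hq
    · exact absurd rfl hpq
    · exact hφp q hq
    · exact hpx p hp
    · exact h0 p hp q hq hpq
  · have hd : d = x + ∑ p ∈ s, p.2 d • p.1 := by rw [hx, sub_add_cancel]
    rw [hd]
    refine Submodule.add_mem _ (Submodule.subset_span ⟨(x, φ), by simp, rfl⟩) ?_
    exact Submodule.span_mono (Set.image_mono (by simp)) hspan

/-- A separable infinite-dimensional normed space has a biorthogonal sequence whose vectors have
dense span. -/
theorem exists_biorthogonal_dense_span [TopologicalSpace.SeparableSpace E]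
    (hE : ¬ FiniteDimensional 𝕜 E) :
    ∃ (x : ℕ → E) (φ : ℕ → E →L[𝕜] 𝕜), (∀ i j, φ i (x j) = if i = j then 1 else 0) ∧
      Dense (Submodule.span 𝕜 (Set.range x) : Set E) := by
  classical
  choose! step hstep hsub hmem using
    fun (s : Finset (E × (E →L[𝕜] 𝕜))) (hs : IsBiorthogonal (s : Set (E × (E →L[𝕜] 𝕜)))) =>
      hs.exists_superset_mem_span
  obtain ⟨S, hS0, hSs⟩ : ∃ S : ℕ → Finset (E × (E →L[𝕜] 𝕜)), S 0 = ∅ ∧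
      ∀ n, S (n + 1) = step (S n) (TopologicalSpace.denseSeq E n) :=
    ⟨fun n => Nat.rec ∅ (fun k s => step s (TopologicalSpace.denseSeq E k)) n, rfl, fun _ => rfl⟩
  have hS : ∀ n, IsBiorthogonal (S n : Set (E × (E →L[𝕜] 𝕜))) := by
    intro n
    induction n with
    | zero => simp [hS0, IsBiorthogonal]
    | succ n ih =>
      rw [hSs]
      exact hstep _ ih _
  have hmono : Monotone S := monotone_nat_of_le_succ fun n => by
    rw [hSs]
    exact hsub _ (hS n) _
  set A : Set (E × (E →L[𝕜] 𝕜)) := ⋃ n, (S n : Set (E × (E →L[𝕜] 𝕜))) with hA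
  have hAb : IsBiorthogonal A := by
    refine ⟨fun p hp => ?_, fun p hp q hq hpq => ?_⟩
    · obtain ⟨n, hn⟩ := Set.mem_iUnion.1 hp
      exact (hS n).1 p hn
    · obtain ⟨n, hn⟩ := Set.mem_iUnion.1 hp
      obtain ⟨m, hm⟩ := Set.mem_iUnion.1 hq
      exact (hS (max n m)).2 p (hmono (le_max_left n m) hn) q (hmono (le_max_right n m) hm) hpq
  have hdense : Dense (Submodule.span 𝕜 (Prod.fst '' A) : Set E) := by
    refine (TopologicalSpace.denseRange_denseSeq E).mono ?_
    rintro _ ⟨k, rfl⟩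
    have h := hmem _ (hS k) (TopologicalSpace.denseSeq E k)
    rw [← hSs] at h
    exact Submodule.span_mono (Set.image_mono (Set.subset_iUnion_of_subset (k + 1) subset_rfl)) h
  have hAc : A.Countable := Set.countable_iUnion fun n => (S n).countable_toSet
  have hAi : A.Infinite := by
    intro hfin
    have : FiniteDimensional 𝕜 (Submodule.span 𝕜 (Prod.fst '' A)) :=
      FiniteDimensional.span_of_finite 𝕜 (hfin.image _)
    have hcl := (Submodule.span 𝕜 (Prod.fst '' A)).closed_of_finiteDimensional
    have htop : Submodule.span 𝕜 (Prod.fst '' A) = ⊤ := by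
      rw [← SetLike.coe_set_eq, ← hcl.closure_eq, hdense.closure_eq, Submodule.top_coe]
    rw [htop] at this
    exact hE (Module.Finite.equiv (Submodule.topEquiv (R := 𝕜) (M := E)))
  obtain ⟨hden⟩ := Set.countable_infinite_iff_nonempty_denumerable.1 ⟨hAc, hAi⟩
  let e : ℕ ≃ A := (Denumerable.eqv A).symm
  refine ⟨fun n => (e n).1.1, fun n => (e n).1.2, fun i j => ?_, ?_⟩
  · split_ifs with hij
    · subst hij
      exact hAb.1 _ (e i).2
    · exact hAb.2 _ (e i).2 _ (e j).2 fun h => hij (e.injective (Subtype.ext h))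
  · have hr : Set.range (fun n => (e n).1.1) = Prod.fst '' A := by
      ext z
      constructor
      · rintro ⟨n, rfl⟩
        exact ⟨_, (e n).2, rfl⟩
      · rintro ⟨p, hp, rfl⟩
        exact ⟨e.symm ⟨p, hp⟩, by simp⟩
    rw [hr]
    exact hdense

/-- The biorthogonal sequence can be rescaled so that each functional is small compared with
binomial combinations of the preceding vectors. -/
theorem exists_rapid_biorthogonal_dense_span [TopologicalSpace.SeparableSpace E]
    (hE : ¬ FiniteDimensional 𝕜 E) :
    ∃ (y : ℕ → E) (ψ : ℕ → E →L[𝕜] 𝕜), (∀ i j, ψ i (y j) = if i = j then 1 else 0) ∧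
      Dense (Submodule.span 𝕜 (Set.range y) : Set E) ∧
      ∀ k, ‖ψ k‖ * ∑ j ∈ Finset.range k, (k.choose j : ℝ) * ‖y j‖ ≤ (1 / 2) ^ k := by
  obtain ⟨x, φ, hb, hd⟩ := exists_biorthogonal_dense_span (𝕜 := 𝕜) hE
  have hx : ∀ k, x k ≠ 0 := by
    intro k h
    have := hb k k
    simp [h] at this
  have hxn : ∀ k, 0 < ‖x k‖ := fun k => norm_pos_iff.2 (hx k)
  -- With `‖y k‖ = c k`, the binomial sum is at most `2 ^ k * c (k - 1)` for `k ≥ 1`, and `‖ψ k‖ =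
  -- ‖x k‖ * ‖φ k‖ / c k`. The factor `4 ^ i` in `c k / c (k - 1) = a k` absorbs `2 ^ k` and leaves
  -- `2 ^ (-k)`.
  let a : ℕ → ℝ := fun i => 1 + 4 ^ i * (‖x i‖ * ‖φ i‖)
  have ha : ∀ i, 1 ≤ a i := fun i => le_add_of_nonneg_right (by positivity)
  let c : ℕ → ℝ := fun k => ∏ i ∈ Finset.range (k + 1), a i
  have hcs : ∀ k, c (k + 1) = c k * a (k + 1) := fun k => Finset.prod_range_succ _ _
  have hc : ∀ k, 0 < c k := fun k => Finset.prod_pos fun i _ => zero_lt_one.trans_le (ha i)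
  have hcm : Monotone c := monotone_nat_of_le_succ fun k => by
    rw [hcs]
    exact le_mul_of_one_le_right (hc k).le (ha _)
  let r : ℕ → ℝ := fun k => c k / ‖x k‖
  have hr : ∀ k, 0 < r k := fun k => div_pos (hc k) (hxn k)
  have hr' : ∀ k, (r k : 𝕜) ≠ 0 := fun k => by exact_mod_cast (hr k).ne'
  have hy : ∀ k, ‖(r k : 𝕜) • x k‖ = c k := by
    intro k
    rw [norm_smul, RCLike.norm_ofReal, abs_of_pos (hr k)]
    exact div_mul_cancel₀ _ (hxn k).ne'
  refine ⟨fun k => (r k : 𝕜) • x k, fun k => (r k : 𝕜)⁻¹ • φ k, fun i j => ?_, ?_, fun k => ?_⟩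
  · simp only [smul_apply, map_smul, hb, smul_eq_mul]
    split_ifs with hij
    · subst hij
      simp [hr' i]
    · simp
  · refine hd.mono ?_
    refine Submodule.span_le.2 ?_
    rintro _ ⟨k, rfl⟩
    have h := Submodule.smul_mem (Submodule.span 𝕜 (Set.range fun k => (r k : 𝕜) • x k))
      (r k : 𝕜)⁻¹ (Submodule.subset_span ⟨k, rfl⟩)
    simp only [inv_smul_smul₀ (hr' k)] at h
    exact h
  · simp only [hy]
    cases k with
    | zero => simp
    | succ k =>
      have hsum : ∑ j ∈ Finset.range (k + 1), ((k + 1).choose j : ℝ) * c j ≤ 2 ^ (k + 1) * c k := by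
        calc ∑ j ∈ Finset.range (k + 1), ((k + 1).choose j : ℝ) * c j
            ≤ ∑ j ∈ Finset.range (k + 1), ((k + 1).choose j : ℝ) * c k := by
              refine Finset.sum_le_sum fun j hj => ?_
              have : c j ≤ c k := hcm (Nat.lt_succ_iff.1 (Finset.mem_range.1 hj))
              gcongr
          _ ≤ ∑ j ∈ Finset.range (k + 1 + 1), ((k + 1).choose j : ℝ) * c k := by
              refine Finset.sum_le_sum_of_subset_of_nonneg
                (Finset.range_mono (Nat.le_succ _)) fun j _ _ => ?_
              exact mul_nonneg (Nat.cast_nonneg _) (hc k).le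
          _ = 2 ^ (k + 1) * c k := by
              rw [← Finset.sum_mul, ← Nat.cast_sum, Nat.sum_range_choose]
              push_cast
              rfl
      have hψ : ‖(r (k + 1) : 𝕜)⁻¹ • φ (k + 1)‖ = ‖x (k + 1)‖ * ‖φ (k + 1)‖ / c (k + 1) := by
        rw [norm_smul, norm_inv, RCLike.norm_ofReal, abs_of_pos (hr _)]
        simp only [r, inv_div]
        ring
      rw [hψ]
      refine (mul_le_mul_of_nonneg_left hsum (div_nonneg (mul_nonneg (norm_nonneg _) (norm_nonneg _)) (hc _).le)).trans ?_
      have ha' : 4 ^ (k + 1) * (‖x (k + 1)‖ * ‖φ (k + 1)‖) ≤ a (k + 1) :=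
        le_add_of_nonneg_left zero_le_one
      have hapos : 0 < a (k + 1) := zero_lt_one.trans_le (ha _)
      have h4 : (4 : ℝ) ^ (k + 1) = 2 ^ (k + 1) * 2 ^ (k + 1) := by rw [← mul_pow]; norm_num
      rw [h4] at ha'
      rw [hcs, one_div, inv_pow, div_mul_eq_mul_div, div_le_iff₀ (mul_pos (hc k) hapos),
        ← div_eq_inv_mul, le_div_iff₀ (by positivity)]
      calc ‖x (k + 1)‖ * ‖φ (k + 1)‖ * (2 ^ (k + 1) * c k) * 2 ^ (k + 1)
          = 2 ^ (k + 1) * 2 ^ (k + 1) * (‖x (k + 1)‖ * ‖φ (k + 1)‖) * c k := by ring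
        _ ≤ a (k + 1) * c k := mul_le_mul_of_nonneg_right ha' (hc k).le
        _ = c k * a (k + 1) := mul_comm _ _

end Biorthogonal

/-! ### Translation of polynomials as a bounded operator -/

section Translation

variable {𝕜 E : Type*} [RCLike 𝕜] [NormedAddCommGroup E] [NormedSpace 𝕜 E]

/-- On a separable infinite-dimensional Banach space the translation of polynomials by `1` can be
realized as a bounded operator on a dense copy of the polynomials. -/
theorem exists_translation_operator [CompleteSpace E] [TopologicalSpace.SeparableSpace E]
    (hE : ¬ FiniteDimensional 𝕜 E) :
    ∃ (T : E →L[𝕜] E) (Φ : Polynomial 𝕜 →ₗ[𝕜] E) (ψ : ℕ → E →L[𝕜] 𝕜),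
      DenseRange Φ ∧ (∀ p, T (Φ p) = Φ (Polynomial.taylor 1 p)) ∧
      ∀ i j, ψ i (Φ (Polynomial.X ^ j)) = if i = j then 1 else 0 := by
  obtain ⟨y, ψ, hb, hd, hsmall⟩ := exists_rapid_biorthogonal_dense_span (𝕜 := 𝕜) hE
  let Φ : Polynomial 𝕜 →ₗ[𝕜] E := (Polynomial.basisMonomials 𝕜).constr 𝕜 y
  have hΦ : ∀ k, Φ (Polynomial.X ^ k) = y k := by
    intro k
    have := (Polynomial.basisMonomials 𝕜).constr_basis 𝕜 y k
    rw [Polynomial.coe_basisMonomials] at this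
    simpa only [← Polynomial.X_pow_eq_monomial] using this
  -- `v k` is the image of `(X + 1) ^ k - X ^ k`, so `T` must be the identity plus `∑ ψ k ⊗ v k`.
  let v : ℕ → E := fun k => ∑ j ∈ Finset.range k, (k.choose j : 𝕜) • y j
  have hv : ∀ k, Φ (Polynomial.taylor 1 (Polynomial.X ^ k)) = y k + v k := by
    intro k
    rw [Polynomial.taylor_X_pow, Polynomial.C_1, add_pow, Finset.sum_range_succ, map_add, map_sum,
      add_comm]
    congr 1
    · simp [hΦ]
    · refine Finset.sum_congr rfl fun j _ => ?_
      rw [one_pow, mul_one, ← hΦ j, ← map_smul, Polynomial.smul_eq_C_mul, mul_comm]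
      simp
  have hnorm : ∀ k, ‖(ψ k).smulRight (v k)‖ ≤ (1 / 2) ^ k := by
    intro k
    rw [ContinuousLinearMap.norm_smulRight_apply]
    refine le_trans (mul_le_mul_of_nonneg_left ?_ (norm_nonneg _)) (hsmall k)
    refine (norm_sum_le _ _).trans (Finset.sum_le_sum fun j _ => ?_)
    rw [norm_smul, RCLike.norm_natCast]
  have hsum : Summable fun k => (ψ k).smulRight (v k) :=
    Summable.of_norm_bounded summable_geometric_two hnorm
  let T : E →L[𝕜] E := 1 + ∑' k, (ψ k).smulRight (v k)
  have hT : ∀ k, T (y k) = y k + v k := by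
    intro k
    have h1 : HasSum (fun i => (ψ i).smulRight (v i) (y k))
        ((∑' i, (ψ i).smulRight (v i)) (y k)) :=
      hsum.hasSum.mapL (ContinuousLinearMap.apply 𝕜 E (y k))
    have h2 : HasSum (fun i => (ψ i).smulRight (v i) (y k)) (v k) := by
      have := hasSum_single (f := fun i => (ψ i).smulRight (v i) (y k)) k fun i hi => by
        simp [hb, hi]
      simpa [hb] using this
    change y k + (∑' i, (ψ i).smulRight (v i)) (y k) = _
    rw [h1.unique h2]
  refine ⟨T, Φ, ψ, ?_, fun p => ?_, fun i j => by rw [hΦ, hb]⟩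
  · have : Set.range Φ = (Submodule.span 𝕜 (Set.range y) : Set E) := by
      rw [← LinearMap.coe_range, (Polynomial.basisMonomials 𝕜).constr_range]
    rw [DenseRange, this]
    exact hd
  · have : (T : E →ₗ[𝕜] E) ∘ₗ Φ = Φ ∘ₗ Polynomial.taylor 1 := by
      refine (Polynomial.basisMonomials 𝕜).ext fun k => ?_
      rw [Polynomial.coe_basisMonomials]
      simp only [← Polynomial.X_pow_eq_monomial]
      rw [LinearMap.comp_apply, LinearMap.comp_apply, hv, hΦ]
      exact hT k
    exact LinearMap.congr_fun this p

theorem pow_apply_eq_taylor {T : E →L[𝕜] E} {Φ : Polynomial 𝕜 →ₗ[𝕜] E}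
    (hT : ∀ p, T (Φ p) = Φ (Polynomial.taylor 1 p)) (n : ℕ) (p : Polynomial 𝕜) :
    (T ^ n) (Φ p) = Φ (Polynomial.taylor (n : 𝕜) p) := by
  induction n generalizing p with
  | zero => simp
  | succ n ih =>
    rw [pow_succ, mul_apply_eq_comp, hT, ih, Polynomial.taylor_taylor]
    push_cast
    rfl

/-- `Φ` need not be continuous for any topology on polynomials; peeling off one factor `1 + s X` at
a time shows the expression is polynomial in `s` with coefficients in `E`. -/
theorem continuous_apply_X_pow_mul_one_add_C_mul_X_pow (Φ : Polynomial 𝕜 →ₗ[𝕜] E) (a b : ℕ) :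
    Continuous fun s : 𝕜 =>
      Φ (Polynomial.X ^ a * (1 + Polynomial.C s * Polynomial.X) ^ b) := by
  induction b generalizing a with
  | zero => simpa using continuous_const
  | succ b ih =>
    have h : ∀ s : 𝕜, Φ (Polynomial.X ^ a * (1 + Polynomial.C s * Polynomial.X) ^ (b + 1)) =
        Φ (Polynomial.X ^ a * (1 + Polynomial.C s * Polynomial.X) ^ b) +
        s • Φ (Polynomial.X ^ (a + 1) * (1 + Polynomial.C s * Polynomial.X) ^ b) := by
      intro s
      rw [← map_smul, ← map_add, Polynomial.smul_eq_C_mul]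
      congr 1
      ring
    simp only [h]
    exact (ih a).add (continuous_id.smul (ih (a + 1)))

theorem tendsto_apply_X_pow_mul_one_add_C_mul_X_pow (Φ : Polynomial 𝕜 →ₗ[𝕜] E) (a b : ℕ)
    {s : ℕ → 𝕜} (hs : Tendsto s atTop (𝓝 0)) :
    Tendsto (fun n => Φ (Polynomial.X ^ a * (1 + Polynomial.C (s n) * Polynomial.X) ^ b)) atTop
      (𝓝 (Φ (Polynomial.X ^ a))) := by
  have := ((continuous_apply_X_pow_mul_one_add_C_mul_X_pow Φ a b).tendsto 0).comp hs
  simpa [Function.comp_def] using this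

/-- The pairs `(v, u)` that are joined asymptotically by the powers of `T`. -/
def asymptoticPairs (T : E →L[𝕜] E) : Submodule 𝕜 (E × E) where
  carrier := {q | ∃ z : ℕ → E, Tendsto z atTop (𝓝 q.1) ∧
    Tendsto (fun n => (T ^ n) (z n)) atTop (𝓝 q.2)}
  add_mem' := by
    rintro q q' ⟨z, hz, hz'⟩ ⟨w, hw, hw'⟩
    refine ⟨fun n => z n + w n, hz.add hw, ?_⟩
    simpa using hz'.add hw'
  zero_mem' := ⟨fun _ => 0, by simp, by simp⟩
  smul_mem' := by
    rintro c q ⟨z, hz, hz'⟩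
    refine ⟨fun n => c • z n, hz.const_smul c, ?_⟩
    simpa using hz'.const_smul c

/-- By linearity it suffices to collapse and to reach monomials. Translation by `n` turns `1 - X/n`
into `-X/n` and `X` into `n (1 + X/n)`; the unequal exponents `k` and `k + 1` leave a factor `1/n`,
after translation for the collapse and before it for the blow-up. -/
theorem mem_asymptoticPairs_of_translation {T : E →L[𝕜] E} {Φ : Polynomial 𝕜 →ₗ[𝕜] E}
    (hT : ∀ p, T (Φ p) = Φ (Polynomial.taylor 1 p)) (p q : Polynomial 𝕜) :
    (Φ p, Φ q) ∈ asymptoticPairs T := by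
  have hs : Tendsto (fun n : ℕ => ((n : 𝕜))⁻¹) atTop (𝓝 0) := tendsto_inv_atTop_nhds_zero_nat
  have hs' : Tendsto (fun n : ℕ => -((n : 𝕜))⁻¹) atTop (𝓝 0) := by simpa using hs.neg
  have hC : ∀ n : ℕ, 1 ≤ n →
      (Polynomial.C ((n : 𝕜)⁻¹) * Polynomial.C (n : 𝕜) : Polynomial 𝕜) = 1 := by
    intro n hn
    rw [← Polynomial.C_mul, inv_mul_cancel₀ (Nat.cast_ne_zero.2 (by omega)), Polynomial.C_1]
  have hone : ∀ r : 𝕜, Polynomial.taylor r (1 : Polynomial 𝕜) = 1 := fun r => by simp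
  have collapse : ∀ k : ℕ, (Φ (Polynomial.X ^ k), 0) ∈ asymptoticPairs T := by
    intro k
    refine ⟨fun n => Φ (Polynomial.X ^ k *
      (1 + Polynomial.C (-(n : 𝕜)⁻¹) * Polynomial.X) ^ (k + 1)),
      tendsto_apply_X_pow_mul_one_add_C_mul_X_pow Φ k (k + 1) hs', ?_⟩
    have hlim := (hs.smul (tendsto_apply_X_pow_mul_one_add_C_mul_X_pow Φ (k + 1) k hs)).const_smul
      ((-1 : 𝕜) ^ (k + 1))
    simp only [zero_smul, smul_zero] at hlim
    refine hlim.congr' ?_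
    filter_upwards [eventually_ge_atTop 1] with n hn
    rw [pow_apply_eq_taylor hT, ← map_smul, ← map_smul]
    congr 1
    simp only [Polynomial.taylor_mul, Polynomial.taylor_pow, map_add, Polynomial.taylor_X,
      Polynomial.taylor_C, hone, Polynomial.smul_eq_C_mul, map_pow, map_neg, Polynomial.C_1]
    have h1 : (1 : Polynomial 𝕜) + -Polynomial.C ((n : 𝕜)⁻¹) *
        (Polynomial.X + Polynomial.C (n : 𝕜)) =
        -(Polynomial.C ((n : 𝕜)⁻¹) * Polynomial.X) := by
      linear_combination (-1 : Polynomial 𝕜) * hC n hn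
    have h2 : (1 : Polynomial 𝕜) + Polynomial.C ((n : 𝕜)⁻¹) * Polynomial.X =
        Polynomial.C ((n : 𝕜)⁻¹) * (Polynomial.X + Polynomial.C (n : 𝕜)) := by
      linear_combination (-1 : Polynomial 𝕜) * hC n hn
    rw [h1, h2, neg_pow (Polynomial.C ((n : 𝕜)⁻¹) * Polynomial.X), mul_pow, mul_pow]
    ring
  have blowUp : ∀ k : ℕ, (0, Φ (Polynomial.X ^ k)) ∈ asymptoticPairs T := by
    intro k
    refine ⟨fun n => (n : 𝕜)⁻¹ • (-1 : 𝕜) ^ k • Φ (Polynomial.X ^ (k + 1) *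
      (1 + Polynomial.C (-(n : 𝕜)⁻¹) * Polynomial.X) ^ k), ?_, ?_⟩
    · have hlim := hs.smul ((tendsto_apply_X_pow_mul_one_add_C_mul_X_pow Φ (k + 1) k
        hs').const_smul ((-1 : 𝕜) ^ k))
      simpa only [zero_smul] using hlim
    · refine (tendsto_apply_X_pow_mul_one_add_C_mul_X_pow Φ k (k + 1) hs).congr' ?_
      filter_upwards [eventually_ge_atTop 1] with n hn
      rw [← map_smul, ← map_smul, pow_apply_eq_taylor hT]
      congr 1
      simp only [Polynomial.taylor_mul, Polynomial.taylor_pow, map_add, Polynomial.taylor_X,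
        Polynomial.taylor_C, hone, Polynomial.smul_eq_C_mul, map_pow, map_neg, Polynomial.C_1]
      have h1 : (1 : Polynomial 𝕜) + -Polynomial.C ((n : 𝕜)⁻¹) *
          (Polynomial.X + Polynomial.C (n : 𝕜)) =
          -(Polynomial.C ((n : 𝕜)⁻¹) * Polynomial.X) := by
        linear_combination (-1 : Polynomial 𝕜) * hC n hn
      have h2 : (1 : Polynomial 𝕜) + Polynomial.C ((n : 𝕜)⁻¹) * Polynomial.X =
          Polynomial.C ((n : 𝕜)⁻¹) * (Polynomial.X + Polynomial.C (n : 𝕜)) := by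
        linear_combination (-1 : Polynomial 𝕜) * hC n hn
      have h3 : ((-1 : Polynomial 𝕜) ^ k) * (-1) ^ k = 1 := by
        rw [← mul_pow]
        simp
      rw [h1, h2, neg_pow (Polynomial.C ((n : 𝕜)⁻¹) * Polynomial.X), mul_pow, mul_pow]
      linear_combination (-(Polynomial.C ((n : 𝕜)⁻¹) ^ (k + 1) * Polynomial.X ^ k *
        (Polynomial.X + Polynomial.C (n : 𝕜)) ^ (k + 1))) * h3
  have hp : (Φ p, (0 : E)) ∈ asymptoticPairs T := by
    induction p using Polynomial.induction_on' with
    | add p q hp hq => simpa using add_mem hp hq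
    | monomial k c =>
      rw [← Polynomial.C_mul_X_pow_eq_monomial, ← Polynomial.smul_eq_C_mul, map_smul]
      simpa using (asymptoticPairs T).smul_mem c (collapse k)
  have hq : ((0 : E), Φ q) ∈ asymptoticPairs T := by
    induction q using Polynomial.induction_on' with
    | add p q hp hq => simpa using add_mem hp hq
    | monomial k c =>
      rw [← Polynomial.C_mul_X_pow_eq_monomial, ← Polynomial.smul_eq_C_mul, map_smul]
      simpa using (asymptoticPairs T).smul_mem c (blowUp k)
  simpa using add_mem hp hq

end Translation

/-! ### A universal orbit for `T ⊕ T` by Baire category -/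

/-- Birkhoff's theorem for `T ⊕ T`: if a dense set of points can be joined asymptotically by the
powers of `T`, some pair of vectors has an orbit that clusters everywhere. -/
theorem exists_mapClusterPt_orbit {𝕜 E : Type*} [RCLike 𝕜] [NormedAddCommGroup E]
    [NormedSpace 𝕜 E] [CompleteSpace E] [TopologicalSpace.SeparableSpace E] {T : E →L[𝕜] E}
    {D : Set E} (hD : Dense D) (hT : ∀ v ∈ D, ∀ u ∈ D, (v, u) ∈ asymptoticPairs T) :
    ∃ e₁ e₂ : E, ∀ z₁ z₂ : E,
      MapClusterPt (z₁, z₂) atTop fun n : ℕ => ((T ^ n) e₁, (T ^ n) e₂) := by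
  have : SecondCountableTopology E := UniformSpace.secondCountable_of_separable E
  obtain ⟨b, hbc, hbe, hb⟩ := TopologicalSpace.exists_countable_basis (E × E)
  have := hbc.to_subtype
  let F : ℕ → E × E → E × E := fun n q => ((T ^ n) q.1, (T ^ n) q.2)
  have hF : ∀ n, Continuous (F n) := fun n => by fun_prop
  let G : b × ℕ → Set (E × E) := fun i => ⋃ n ≥ i.2, F n ⁻¹' i.1
  have hGo : ∀ i, IsOpen (G i) := fun i =>
    isOpen_biUnion fun n _ => (hb.isOpen i.1.2).preimage (hF n)
  have hGd : ∀ i, Dense (G i) := by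
    rintro ⟨⟨B, hB⟩, m⟩
    have hBne : B.Nonempty := Set.nonempty_iff_ne_empty.2 fun h => hbe (h ▸ hB)
    refine dense_iff_inter_open.2 fun A hA hAne => ?_
    obtain ⟨⟨v₁, v₂⟩, hvA, hv₁, hv₂⟩ := (hD.prod hD).inter_open_nonempty A hA hAne
    obtain ⟨⟨u₁, u₂⟩, huB, hu₁, hu₂⟩ := (hD.prod hD).inter_open_nonempty B (hb.isOpen hB) hBne
    obtain ⟨z₁, hz₁, hz₁'⟩ := hT v₁ hv₁ u₁ hu₁
    obtain ⟨z₂, hz₂, hz₂'⟩ := hT v₂ hv₂ u₂ hu₂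
    -- Asymptotic pairs converge along all `n`, so one `n` serves both coordinates.
    have h1 := (hz₁.prodMk_nhds hz₂).eventually (hA.mem_nhds hvA)
    have h2 := (hz₁'.prodMk_nhds hz₂').eventually ((hb.isOpen hB).mem_nhds huB)
    obtain ⟨n, hn1, hn2, hn⟩ := (h1.and (h2.and (eventually_ge_atTop m))).exists
    exact ⟨(z₁ n, z₂ n), hn1, Set.mem_biUnion hn hn2⟩
  obtain ⟨⟨e₁, e₂⟩, he⟩ := (dense_iInter_of_isOpen hGo hGd).nonempty
  refine ⟨e₁, e₂, fun z₁ z₂ => mapClusterPt_iff_frequently.2 fun s hs => ?_⟩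
  obtain ⟨B, hB, hzB, hBs⟩ := hb.mem_nhds_iff.1 hs
  refine frequently_atTop.2 fun m => ?_
  obtain ⟨n, hn, hnB⟩ := Set.mem_iUnion₂.1 (Set.mem_iInter.1 he (⟨B, hB⟩, m))
  exact ⟨n, hn, hBs hnB⟩

/-! ### The conjugate by a rank-two perturbation -/

section Conjugate

variable {𝕜 E : Type*} [RCLike 𝕜] [NormedAddCommGroup E] [NormedSpace 𝕜 E]

/-- The perturbed operator `R = 1 + f₁ ⊗ e₁ + f₂ ⊗ e₂` conjugates `T` into an operator that, paired
with `T`, has the Disjoint Blow-up/Collapse property. -/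
theorem disjointBlowUpCollapse_conjugate {T : E →L[𝕜] E} {D : Set E} (hD : Dense D)
    (hT : ∀ v ∈ D, ∀ u ∈ D, (v, u) ∈ asymptoticPairs T) (h0 : (0 : E) ∈ D) {e₁ e₂ : E}
    (he : ∀ z₁ z₂ : E, MapClusterPt (z₁, z₂) atTop fun n : ℕ => ((T ^ n) e₁, (T ^ n) e₂))
    {f₁ f₂ : E →L[𝕜] 𝕜} {g₁ g₂ : E} (h₁₁ : f₁ g₁ = 1) (h₁₂ : f₁ g₂ = 0) (h₂₂ : f₂ g₂ = 1)
    (hg : ∀ c : 𝕜, c • g₂ ∈ D) (R : (E →L[𝕜] E)ˣ)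
    (hR : ∀ x, (R : E →L[𝕜] E) x = x + f₁ x • e₁ + f₂ x • e₂) :
    DisjointBlowUpCollapse ![T, ↑R⁻¹ * T * ↑R] := by
  intro W V U hW h0W hV hU
  have hinv : ∀ x, (↑R⁻¹ : E →L[𝕜] E) ((R : E →L[𝕜] E) x) = x := fun x => by
    rw [← mul_apply_eq_comp, Units.inv_mul, one_apply_eq_self]
  have hTR : ∀ (n : ℕ) (x : E), ((↑R⁻¹ * T * ↑R : E →L[𝕜] E) ^ n) x =
      (↑R⁻¹ : E →L[𝕜] E) ((T ^ n) x + f₁ x • (T ^ n) e₁ + f₂ x • (T ^ n) e₂) := by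
    intro n x
    rw [Units.conj_pow', mul_apply_eq_comp, mul_apply_eq_comp, hR]
    simp only [map_add, map_smul]
  have hopen : IsOpen {x : E | f₁ x ≠ 0} := isOpen_ne_fun f₁.continuous continuous_const
  -- `f₁ v ≠ 0` is what allows `f₁ v • z₁ + f₂ v • z₂ = 0` to be solved for `z₁`, whatever `z₂` is.
  have hVne : (V 0 ∩ {x : E | f₁ x ≠ 0}).Nonempty := by
    obtain ⟨v, hv⟩ := (hV 0).2
    by_cases hfv : f₁ v = 0
    · have hc : Tendsto (fun t : 𝕜 => v + t • g₁) (𝓝[≠] 0) (𝓝 v) := by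
        have : Continuous fun t : 𝕜 => v + t • g₁ := by fun_prop
        simpa using (this.tendsto 0).mono_left nhdsWithin_le_nhds
      obtain ⟨t, htV, ht⟩ := ((hc.eventually ((hV 0).1.mem_nhds hv)).and
        (self_mem_nhdsWithin : {(0 : 𝕜)}ᶜ ∈ 𝓝[≠] (0 : 𝕜))).exists
      exact ⟨_, htV, by simpa [hfv, h₁₁] using ht⟩
    · exact ⟨v, hv, hfv⟩
  obtain ⟨v, ⟨hvV, hfv⟩, hvD⟩ := hD.inter_open_nonempty _ ((hV 0).1.inter hopen) hVne
  obtain ⟨u₁, hu₁, hu₁D⟩ := hD.inter_open_nonempty _ (hU 0).1 (hU 0).2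
  obtain ⟨u₂, hu₂⟩ := (hU 1).2
  obtain ⟨c, hcW, hc⟩ : ∃ c : 𝕜, c • g₂ ∈ W ∧ c ≠ 0 := by
    have hlim : Tendsto (fun t : 𝕜 => t • g₂) (𝓝[≠] 0) (𝓝 0) := by
      have : Continuous fun t : 𝕜 => t • g₂ := by fun_prop
      simpa using (this.tendsto 0).mono_left nhdsWithin_le_nhds
    exact ((hlim.eventually (hW.mem_nhds h0W)).and
      (self_mem_nhdsWithin : {(0 : 𝕜)}ᶜ ∈ 𝓝[≠] (0 : 𝕜))).exists
  -- The blow-up starts near `c • g₂`, where `f₁ = 0` and `f₂ = c`; this `z₂` gives `u₁ + c • z₂ = R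
  -- u₂`.
  set z₂ : E := c⁻¹ • ((R : E →L[𝕜] E) u₂ - u₁) with hz₂
  set z₁ : E := -((f₂ v / f₁ v) • z₂) with hz₁
  -- An ultrafilter turns clustering into convergence, to be combined with the limits along `atTop`.
  obtain ⟨L, hL, hLe⟩ := mapClusterPt_iff_ultrafilter.1 (he z₁ z₂)
  have hL₁ : Tendsto (fun n : ℕ => (T ^ n) e₁) L (𝓝 z₁) := (continuous_fst.tendsto _).comp hLe
  have hL₂ : Tendsto (fun n : ℕ => (T ^ n) e₂) L (𝓝 z₂) := (continuous_snd.tendsto _).comp hLe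
  have hconj : ∀ (x : ℕ → E) (a b : E), Tendsto x atTop (𝓝 a) →
      Tendsto (fun n => (T ^ n) (x n)) atTop (𝓝 b) →
      Tendsto (fun n => ((↑R⁻¹ * T * ↑R : E →L[𝕜] E) ^ n) (x n)) L
        (𝓝 ((↑R⁻¹ : E →L[𝕜] E) (b + f₁ a • z₁ + f₂ a • z₂))) := by
    intro x a b hx hTx
    simp only [hTR]
    refine ((↑R⁻¹ : E →L[𝕜] E).continuous.tendsto _).comp ?_
    exact ((hTx.mono_left hL).add
      (((f₁.continuous.tendsto a).comp (hx.mono_left hL)).smul hL₁)).add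
      (((f₂.continuous.tendsto a).comp (hx.mono_left hL)).smul hL₂)
  obtain ⟨x, hx, hTx⟩ := hT _ (hg c) _ hu₁D
  obtain ⟨x', hx', hTx'⟩ := hT _ hvD _ h0
  have hlim : (↑R⁻¹ : E →L[𝕜] E) (u₁ + f₁ (c • g₂) • z₁ + f₂ (c • g₂) • z₂) = u₂ := by
    have : u₁ + f₁ (c • g₂) • z₁ + f₂ (c • g₂) • z₂ = (R : E →L[𝕜] E) u₂ := by
      simp [h₁₂, h₂₂, hz₂, smul_inv_smul₀ hc]
    rw [this, hinv]
  have hlim' : (↑R⁻¹ : E →L[𝕜] E) (0 + f₁ v • z₁ + f₂ v • z₂) = 0 := by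
    have : 0 + f₁ v • z₁ + f₂ v • z₂ = 0 := by
      rw [hz₁, smul_neg, smul_smul, mul_div_cancel₀ _ hfv]
      simp
    rw [this, map_zero]
  have hS := hconj x _ _ hx hTx
  have hS' := hconj x' _ _ hx' hTx'
  simp only at hS hS'
  rw [hlim] at hS
  rw [hlim'] at hS'
  have key := ((((hx.mono_left hL).eventually (hW.mem_nhds hcW)).and
    ((hTx.mono_left hL).eventually ((hU 0).1.mem_nhds hu₁))).and
    (hS.eventually ((hU 1).1.mem_nhds hu₂))).and
    ((((hx'.mono_left hL).eventually ((hV 0).1.mem_nhds hvV)).and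
    ((hTx'.mono_left hL).eventually (hW.mem_nhds h0W))).and
    (hS'.eventually (hW.mem_nhds h0W)))
  obtain ⟨n, ⟨⟨⟨hn₁, hn₂⟩, hn₃⟩, ⟨hn₄, hn₅⟩, hn₆⟩, hn⟩ :=
    (key.and (hL (eventually_ge_atTop 1))).exists
  refine ⟨n, hn, ⟨x n, hn₁, Set.mem_iInter.2 fun i => ?_⟩,
    fun l => ⟨x' n, ?_, Set.mem_iInter.2 fun i => ?_⟩⟩
  · fin_cases i
    · exact hn₂
    · exact hn₃
  · rw [Subsingleton.elim l 0]
    exact hn₄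
  · fin_cases i
    · exact hn₅
    · exact hn₆

/-- Collapsing two sets that are separated by `f₁` and `f₂` forces `T ^ n` to be bounded on `e₁`
and `e₂`, which excludes the blow-up. -/
theorem not_strongDisjointBlowUpCollapse_conjugate {T : E →L[𝕜] E} {e₁ e₂ : E}
    {f₁ f₂ : E →L[𝕜] 𝕜} {g₁ g₂ : E} (h₁₁ : f₁ g₁ = 1) (h₁₂ : f₁ g₂ = 0) (h₂₁ : f₂ g₁ = 0)
    (h₂₂ : f₂ g₂ = 1) (R : (E →L[𝕜] E)ˣ)
    (hR : ∀ x, (R : E →L[𝕜] E) x = x + f₁ x • e₁ + f₂ x • e₂) :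
    ¬ StrongDisjointBlowUpCollapse ![T, ↑R⁻¹ * T * ↑R] := by
  intro hstrong
  have : Nontrivial E := ⟨g₁, 0, fun h => by simp [h] at h₁₁⟩
  -- The collapse will give `‖a‖ + ‖b‖ ≤ 8`, hence a perturbation of norm at most `1` on `W`; the
  -- two unit balls in `U` add `2`, so `‖p‖ ≤ 3`.
  obtain ⟨p, hp⟩ := NormedSpace.exists_lt_norm 𝕜 E 3
  have hinv' : ∀ x, (R : E →L[𝕜] E) ((↑R⁻¹ : E →L[𝕜] E) x) = x := fun x => by
    rw [← mul_apply_eq_comp, Units.mul_inv, one_apply_eq_self]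
  have hTR : ∀ (n : ℕ) (x : E),
      (R : E →L[𝕜] E) (((↑R⁻¹ * T * ↑R : E →L[𝕜] E) ^ n) x) - (T ^ n) x =
        f₁ x • (T ^ n) e₁ + f₂ x • (T ^ n) e₂ := by
    intro n x
    rw [Units.conj_pow', mul_apply_eq_comp, mul_apply_eq_comp, hinv', hR]
    simp only [map_add, map_smul]
    abel
  let W : Set E := {x | ‖x‖ < 1 ∧ ‖(R : E →L[𝕜] E) x‖ < 1 ∧ ‖f₁ x‖ < 1 / 8 ∧ ‖f₂ x‖ < 1 / 8}
  let V : Fin 2 → Set E :=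
    ![{x | ‖f₁ x - 1‖ < 1 / 4 ∧ ‖f₂ x‖ < 1 / 4}, {x | ‖f₁ x‖ < 1 / 4 ∧ ‖f₂ x - 1‖ < 1 / 4}]
  let U : Fin 2 → Set E := ![{x | ‖x‖ < 1}, {x | ‖(R : E →L[𝕜] E) x - p‖ < 1}]
  have hlt : ∀ {h : E → ℝ} {r : ℝ}, Continuous h → IsOpen {x | h x < r} :=
    fun hc => isOpen_lt hc continuous_const
  have hW : IsOpen W := (hlt (by fun_prop)).inter ((hlt (by fun_prop)).inter
    ((hlt (by fun_prop)).inter (hlt (by fun_prop))))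
  have hV : ∀ l, IsOpen (V l) ∧ (V l).Nonempty := by
    intro l
    fin_cases l
    · exact ⟨(hlt (by fun_prop)).inter (hlt (by fun_prop)), g₁, by simp [h₁₁], by simp [h₂₁]⟩
    · exact ⟨(hlt (by fun_prop)).inter (hlt (by fun_prop)), g₂, by simp [h₁₂], by simp [h₂₂]⟩
  have hU : ∀ i, IsOpen (U i) ∧ (U i).Nonempty := by
    intro i
    fin_cases i
    · exact ⟨hlt (by fun_prop), 0, show ‖(0 : E)‖ < 1 by simp⟩
    · refine ⟨hlt (by fun_prop), (↑R⁻¹ : E →L[𝕜] E) p, ?_⟩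
      change ‖(R : E →L[𝕜] E) ((↑R⁻¹ : E →L[𝕜] E) p) - p‖ < 1
      rw [hinv']
      simp
  obtain ⟨n, -, ⟨x, ⟨-, -, hx₁, hx₂⟩, hxU⟩, hcol⟩ :=
    hstrong 2 one_le_two W V U hW ⟨by simp, by simp, by simp, by simp⟩ hV hU
  have hxU₁ : ‖(T ^ n) x‖ < 1 := Set.mem_iInter.1 hxU 0
  have hxU₂ : ‖(R : E →L[𝕜] E) (((↑R⁻¹ * T * ↑R : E →L[𝕜] E) ^ n) x) - p‖ < 1 :=
    Set.mem_iInter.1 hxU 1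
  obtain ⟨y, ⟨hy₁, hy₂⟩, hyW⟩ := hcol 0
  obtain ⟨z, ⟨hz₁, hz₂⟩, hzW⟩ := hcol 1
  have hbound : ∀ w : E, w ∈ (⋂ i, (⇑((![T, ↑R⁻¹ * T * ↑R] : Fin 2 → E →L[𝕜] E) i ^ n)) ⁻¹' W) →
      ‖f₁ w • (T ^ n) e₁ + f₂ w • (T ^ n) e₂‖ < 2 := by
    intro w hw
    have hw₁ : ‖(T ^ n) w‖ < 1 := (Set.mem_iInter.1 hw 0).1
    have hw₂ : ‖(R : E →L[𝕜] E) (((↑R⁻¹ * T * ↑R : E →L[𝕜] E) ^ n) w)‖ < 1 :=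
      (Set.mem_iInter.1 hw 1).2.1
    rw [← hTR]
    exact (norm_sub_le _ _).trans_lt (by linarith)
  have hby := hbound y hyW
  have hbz := hbound z hzW
  set a := (T ^ n) e₁
  set b := (T ^ n) e₂
  -- Diagonal dominance: `(f₁, f₂)` at `y` and `z` is within `1/4` of the identity matrix, so
  -- summing the two bounds absorbs half of `‖a‖ + ‖b‖`.
  have ha : ‖a‖ ≤ 2 + 1 / 4 * ‖a‖ + 1 / 4 * ‖b‖ := by
    have h : a = (f₁ y • a + f₂ y • b) - (f₁ y - 1) • a - f₂ y • b := by
      rw [sub_smul, one_smul]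
      abel
    calc ‖a‖ ≤ ‖f₁ y • a + f₂ y • b‖ + ‖(f₁ y - 1) • a‖ + ‖f₂ y • b‖ := by
          conv_lhs => rw [h]
          exact (norm_sub_le _ _).trans (add_le_add_left (norm_sub_le _ _) _)
      _ ≤ 2 + 1 / 4 * ‖a‖ + 1 / 4 * ‖b‖ := by
          rw [norm_smul, norm_smul]
          gcongr
  have hb : ‖b‖ ≤ 2 + 1 / 4 * ‖a‖ + 1 / 4 * ‖b‖ := by
    have h : b = (f₁ z • a + f₂ z • b) - f₁ z • a - (f₂ z - 1) • b := by
      rw [sub_smul, one_smul]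
      abel
    calc ‖b‖ ≤ ‖f₁ z • a + f₂ z • b‖ + ‖f₁ z • a‖ + ‖(f₂ z - 1) • b‖ := by
          conv_lhs => rw [h]
          exact (norm_sub_le _ _).trans (add_le_add_left (norm_sub_le _ _) _)
      _ ≤ 2 + 1 / 4 * ‖a‖ + 1 / 4 * ‖b‖ := by
          rw [norm_smul, norm_smul]
          gcongr
  have hsmall : ‖f₁ x • a + f₂ x • b‖ ≤ 1 / 8 * ‖a‖ + 1 / 8 * ‖b‖ := by
    refine (norm_add_le _ _).trans ?_
    rw [norm_smul, norm_smul]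
    gcongr
  have hlarge : ‖p‖ ≤ 1 + 1 + ‖f₁ x • a + f₂ x • b‖ := by
    rw [← hTR]
    set q := (R : E →L[𝕜] E) (((↑R⁻¹ * T * ↑R : E →L[𝕜] E) ^ n) x)
    have h : p = -(q - p) + (T ^ n) x + (q - (T ^ n) x) := by abel
    calc ‖p‖ ≤ ‖-(q - p)‖ + ‖(T ^ n) x‖ + ‖q - (T ^ n) x‖ := by
          conv_lhs => rw [h]
          exact norm_add₃_le
      _ ≤ 1 + 1 + ‖q - (T ^ n) x‖ := by
          rw [norm_neg]
          gcongr
  linarith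

end Conjugate

/-! ### Assembly of the counterexample -/

theorem corollary3p4 {𝕜 X : Type*} [RCLike 𝕜] [NormedAddCommGroup X] [NormedSpace 𝕜 X]
    [CompleteSpace X] [TopologicalSpace.SeparableSpace X] (hX : ¬ FiniteDimensional 𝕜 X) :
    ∃ T₁ T₂ : X →L[𝕜] X,
      DisjointBlowUpCollapse ![T₁, T₂] ∧ ¬ StrongDisjointBlowUpCollapse ![T₁, T₂] := by
  obtain ⟨T, Φ, ψ, hΦ, hTΦ, hψ⟩ := exists_translation_operator (𝕜 := 𝕜) hX
  have hT : ∀ v ∈ Set.range Φ, ∀ u ∈ Set.range Φ, (v, u) ∈ asymptoticPairs T := by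
    rintro _ ⟨p, rfl⟩ _ ⟨q, rfl⟩
    exact mem_asymptoticPairs_of_translation hTΦ p q
  obtain ⟨e₁, e₂, he⟩ := exists_mapClusterPt_orbit hΦ hT
  let K : X →L[𝕜] X := (ψ 0).smulRight e₁ + (ψ 1).smulRight e₂
  -- A small `δ` makes `R = 1 + δ • K` invertible by the Neumann series; rescaling the dual vectors
  -- by `δ⁻¹` preserves biorthogonality.
  obtain ⟨δ, hδK, hδ⟩ : ∃ δ : 𝕜, ‖-(δ • K)‖ < 1 ∧ δ ≠ 0 := by
    have hlim : Tendsto (fun t : 𝕜 => ‖-(t • K)‖) (𝓝[≠] 0) (𝓝 0) := by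
      have : Continuous fun t : 𝕜 => ‖-(t • K)‖ := by fun_prop
      simpa using (this.tendsto 0).mono_left nhdsWithin_le_nhds
    exact ((hlim.eventually_lt_const zero_lt_one).and
      (self_mem_nhdsWithin : {(0 : 𝕜)}ᶜ ∈ 𝓝[≠] (0 : 𝕜))).exists
  let R : (X →L[𝕜] X)ˣ := Units.oneSub (-(δ • K)) hδK
  have hR : ∀ x, (R : X →L[𝕜] X) x = x + (δ • ψ 0) x • e₁ + (δ • ψ 1) x • e₂ := by
    intro x
    change x - -(δ • ((ψ 0) x • e₁ + (ψ 1) x • e₂)) = _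
    rw [sub_neg_eq_add, smul_add, smul_smul, smul_smul, ← add_assoc]
    rfl
  have hf : ∀ i j, (δ • ψ i) (δ⁻¹ • Φ (Polynomial.X ^ j)) = if i = j then 1 else 0 := by
    intro i j
    simp only [smul_apply, map_smul, hψ, smul_eq_mul]
    split_ifs <;> simp [hδ]
  have h₁₁ := (hf 0 0).trans (if_pos rfl)
  have h₁₂ := (hf 0 1).trans (if_neg zero_ne_one)
  have h₂₁ := (hf 1 0).trans (if_neg one_ne_zero)
  have h₂₂ := (hf 1 1).trans (if_pos rfl)
  refine ⟨T, ↑R⁻¹ * T * ↑R,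
    disjointBlowUpCollapse_conjugate hΦ hT ⟨0, map_zero Φ⟩ he h₁₁ h₁₂ h₂₂
      (fun c => ⟨c • δ⁻¹ • Polynomial.X ^ 1, by rw [map_smul, map_smul]⟩) R hR,
    not_strongDisjointBlowUpCollapse_conjugate h₁₁ h₁₂ h₂₁ h₂₂ R hR⟩
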